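/- Let $P$ be a complex polynomial with $\deg P\ge 2$ and $P(0)\ne 0$, and let $f(z)=P(e^z)/e^z$ for $z\in\mathbb{C}$. Write $f^{\circ n}$ for the $n$-th iterate of $f$, $M(r)=\max_{|z|=r}|f(z)|$ for $r>0$, and $M^{\circ n}$ for the $n$-th iterate of $M$. For $R>0$ with $M^{\circ n}(R)\to\infty$ as $n\to\infty$, the fast escaping set of $f$ is $$A(f)=\{z\in\mathbb{C}:\ \text{there is }\ell\in\mathbb{N}\text{ with }|f^{\circ(n+\ell)}(z)|\ge M^{\circ n}(R)\text{ for all }n\in\mathbb{N}\}.$$ The Fatou set $F(f)$ is the largest open subset of $\mathbb{C}$ on which the family $\{f^{\circ n}:n\in\mathbb{N}\}$ is normal in the sense of Montel (on every domain in it, every sequence in the family has a subsequence converging locally uniformly to a holomorphic function or to $\infty$), and the Julia set is $J(f)=\mathbb{C}\setminus F(f)$. Then there are $R>0$ with $M^{\circ n}(R)\to\infty$, and for every such $R$, with $A(f)$ defined by means of $R$: (i) for every horizontal strip $S=\{z: a\le \operatorname{Im} z\le a+2\pi\}$, $a\in\mathbb{R}$, the set $S\setminus A(f)$ has finite Lebesgue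 area; (ii) $A(f)\subseteq J(f)$. Consequently $S\cap F(f)$ has finite Lebesgue area for every such strip $S$. -/

import Mathlib

open Filter Topology MeasureTheory

/-- The entire function `f(z) = P(e^z) / e^z` attached to a complex polynomial `P`. -/
noncomputable def expQuotient (P : Polynomial ℂ) (z : ℂ) : ℂ :=
  P.eval (Complex.exp z) / Complex.exp z

/-- The maximum modulus function `M(r, f) = max_{|z| = r} |f z|`. For continuous `f` and `r ≥ 0` the
circle is compact and nonempty, so that the supremum is a maximum. -/
noncomputable def maxModulus (f : ℂ → ℂ) (r : ℝ) : ℝ :=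
  sSup ((fun z => ‖f z‖) '' Metric.sphere (0 : ℂ) r)

/-- The radii which may be used to define the fast escaping set: `R > 0` and the iterates
`M^n(R)` of the maximum modulus function tend to infinity. -/
def IsFastRadius (f : ℂ → ℂ) (R : ℝ) : Prop :=
  0 < R ∧ Tendsto (fun n : ℕ => (maxModulus f)^[n] R) atTop atTop

/-- The fast escaping set of `f`, computed with the radius `R`: the points `z` such that for some
`ℓ` one has `|f^(n+ℓ)(z)| ≥ M^n(R)` for all `n`. -/
def fastEscapingSet (f : ℂ → ℂ) (R : ℝ) : Set ℂ :=
  {z | ∃ ℓ : ℕ, ∀ n : ℕ, (maxModulus f)^[n] R ≤ ‖f^[n + ℓ] z‖}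

/-- A family of functions on a domain `U` is normal in the sense of Montel: every sequence
of members has a subsequence which converges locally uniformly on `U`, either to a holomorphic
function or to infinity. -/
def IsNormalFamilyOn (F : Set (ℂ → ℂ)) (U : Set ℂ) : Prop :=
  ∀ g : ℕ → ℂ → ℂ, (∀ k, g k ∈ F) →
    ∃ φ : ℕ → ℕ, StrictMono φ ∧
      ((∃ h : ℂ → ℂ, DifferentiableOn ℂ h U ∧
          TendstoLocallyUniformlyOn (fun k => g (φ k)) h atTop U) ∨
        (∀ K : Set ℂ, K ⊆ U → IsCompact K →
          ∀ C : ℝ, ∀ᶠ k in atTop, ∀ z ∈ K, C ≤ ‖g (φ k) z‖))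

/-- The Fatou set: the largest open set on which the iterates of `f` are normal, that is, the union
of all domains (open connected sets) on which they form a normal family. -/
def fatouSet (f : ℂ → ℂ) : Set ℂ :=
  ⋃₀ {U : Set ℂ | IsOpen U ∧ IsConnected U ∧ IsNormalFamilyOn (Set.range fun n : ℕ => f^[n]) U}

/-- The Julia set, the complement of the Fatou set. -/
def juliaSet (f : ℂ → ℂ) : Set ℂ := (fatouSet f)ᶜ

/-- The closed horizontal strip of width `2π` whose lower edge is at height `a`. -/
def horizontalStrip (a : ℝ) : Set ℂ :=
  {z | a ≤ z.im ∧ z.im ≤ a + 2 * Real.pi}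

/-! Let `d = deg P`. Far to the right `f` behaves like a multiple of `e^{(d-1)z}`, far to the left
like `P(0) e^{-z}`. Hence for `|Re z|` large, `|f| ≥ c e^{|Re z|}` and `|f'| ≥ |f|/2`
(`exists_asymptotics`).

Area: `f` is at most `d`-to-one on a half-open strip of width `2π`, so a change of variables bounds
the area of the part of `f⁻¹(B)` lying in the strip and far from the imaginary axis by `d ∫_B
4/|w|²`. For `B` periodic and contained in `|Re w| ≥ X` this is at most half the area of `B` in one
strip, once `X` is large. The initial bad set, where `|Re f(z)| < e^{|Re z|/2}`, is mapped into a
region `c (Re w)² ≤ |w|`, on which `|w|⁻²` is integrable away from `0`. A geometric series then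
bounds the area of all points that ever stall (`exists_volume_stallSet`). The orbits of the others
satisfy `|Re|` ↦ at least `e^{|Re|/2}`, which eventually beats `M(r) ≤ K e^{dr}`
(`mem_fastEscapingSet_of_exp_le`).

Julia set: normality near an escaping point would give an open set on which all iterates of `f` are
large. Its images avoid the imaginary axis, so their imaginary parts oscillate by at most `2π`,
which bounds the derivatives of the iterates; yet these grow like `2^n` (`exists_no_open_large`). -/

theorem Polynomial.norm_eval_le_sum (Q : Polynomial ℂ) {n : ℕ} (hn : Q.natDegree ≤ n) (x : ℂ) :
    ‖Q.eval x‖ ≤ ∑ i ∈ Finset.range (n + 1), ‖Q.coeff i‖ * ‖x‖ ^ i := by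
  rw [Polynomial.eval_eq_sum_range' (Nat.lt_succ_of_le hn)]
  refine (norm_sum_le _ _).trans (le_of_eq ?_)
  simp

/-- A polynomial of degree at most `n` is `O(max(1, |x|)^n)`. -/
theorem Polynomial.exists_norm_eval_le (Q : Polynomial ℂ) {n : ℕ} (hn : Q.natDegree ≤ n) :
    ∃ K : ℝ, 0 ≤ K ∧ (∀ x : ℂ, ‖x‖ ≤ 1 → ‖Q.eval x‖ ≤ K) ∧
      ∀ x : ℂ, 1 ≤ ‖x‖ → ‖Q.eval x‖ ≤ K * ‖x‖ ^ n := by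
  refine ⟨∑ i ∈ Finset.range (n + 1), ‖Q.coeff i‖, by positivity, fun x hx => ?_, fun x hx => ?_⟩
  · refine (Q.norm_eval_le_sum hn x).trans (Finset.sum_le_sum fun i _ => ?_)
    exact mul_le_of_le_one_right (norm_nonneg _) (pow_le_one₀ (norm_nonneg _) hx)
  · refine (Q.norm_eval_le_sum hn x).trans ?_
    rw [Finset.sum_mul]
    refine Finset.sum_le_sum fun i hi => ?_
    gcongr
    simpa [Nat.lt_succ_iff] using hi

theorem hasDerivAt_expQuotient (P : Polynomial ℂ) (z : ℂ) :
    HasDerivAt (expQuotient P)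
      (P.derivative.eval (Complex.exp z) - P.eval (Complex.exp z) / Complex.exp z) z := by
  have h := ((P.hasDerivAt (Complex.exp z)).comp z (Complex.hasDerivAt_exp z)).div
    (Complex.hasDerivAt_exp z) (Complex.exp_ne_zero z)
  refine h.congr_deriv ?_
  have := Complex.exp_ne_zero z
  simp only [Function.comp]
  field_simp

theorem differentiable_expQuotient (P : Polynomial ℂ) : Differentiable ℂ (expQuotient P) :=
  fun z => (hasDerivAt_expQuotient P z).differentiableAt

theorem continuous_expQuotient (P : Polynomial ℂ) : Continuous (expQuotient P) :=
  (differentiable_expQuotient P).continuous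

/-! ### Asymptotics in the right and left half-planes -/

/-- `f` and its derivative are close to `a e^{mz}` and its derivative at `z`. -/
def IsNearExp (f : ℂ → ℂ) (a : ℂ) (m : ℤ) (z : ℂ) : Prop :=
  ‖f z - a * Complex.exp (m * z)‖ ≤ 1 / 4 * ‖a * Complex.exp (m * z)‖ ∧
  ‖deriv f z - m * (a * Complex.exp (m * z))‖ ≤ 1 / 4 * ‖a * Complex.exp (m * z)‖

theorem IsNearExp.norm_lower {f : ℂ → ℂ} {a : ℂ} {m : ℤ} {z : ℂ} (h : IsNearExp f a m z) :
    3 / 4 * ‖a * Complex.exp (m * z)‖ ≤ ‖f z‖ := by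
  have := norm_sub_norm_le (a * Complex.exp (m * z)) (f z)
  rw [norm_sub_rev] at this
  linarith [h.1]

/-- With `E = |a e^{mz}|`, one has `|f| ≤ 5E/4` and `|f'| ≥ (|m| - 1/4) E ≥ 3E/4`. -/
theorem IsNearExp.half_norm_le {f : ℂ → ℂ} {a : ℂ} {m : ℤ} {z : ℂ} (h : IsNearExp f a m z)
    (hm : m ≠ 0) : ‖f z‖ / 2 ≤ ‖deriv f z‖ := by
  have h1 := norm_sub_norm_le (f z) (a * Complex.exp (m * z))
  have h2 := norm_sub_norm_le (m * (a * Complex.exp (m * z))) (deriv f z)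
  rw [norm_sub_rev] at h2
  have h3 : ‖a * Complex.exp (m * z)‖ ≤ ‖(m : ℂ) * (a * Complex.exp (m * z))‖ := by
    rw [norm_mul (m : ℂ)]
    refine le_mul_of_one_le_left (norm_nonneg _) ?_
    rw [Complex.norm_intCast]
    exact_mod_cast Int.one_le_abs hm
  linarith [h.1, h.2, norm_nonneg (a * Complex.exp (m * z))]

theorem exists_isNearExp_right (P : Polynomial ℂ) (hdeg : 2 ≤ P.natDegree) :
    ∃ X : ℝ, ∀ z : ℂ, X ≤ z.re →
      IsNearExp (expQuotient P) P.leadingCoeff (P.natDegree - 1 : ℕ) z := by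
  obtain ⟨k, hk⟩ : ∃ k, P.natDegree = k + 2 := ⟨P.natDegree - 2, by omega⟩
  set R := P.eraseLead with hR
  have hRd : R.natDegree ≤ k + 1 := by
    have : R.natDegree ≤ P.natDegree - 1 := P.eraseLead_natDegree_le
    omega
  have hRd' : (Polynomial.derivative R).natDegree ≤ k := by
    have := Polynomial.natDegree_derivative_le R
    omega
  obtain ⟨K, hK0, -, hK⟩ := R.exists_norm_eval_le hRd
  obtain ⟨K', hK'0, -, hK'⟩ := (Polynomial.derivative R).exists_norm_eval_le hRd'
  have ha : P.leadingCoeff ≠ 0 := by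
    rw [Ne, Polynomial.leadingCoeff_eq_zero]
    rintro rfl
    simp at hdeg
  set a := P.leadingCoeff with haa
  have hP : P = R + Polynomial.C a * Polynomial.X ^ (k + 2) := by
    rw [hR, haa, ← hk, Polynomial.eraseLead_add_C_mul_X_pow]
  have ha' : 0 < ‖a‖ := norm_pos_iff.2 ha
  -- Since `Re z ≤ e^{Re z} = |x|`, this threshold makes `(K + K')|x|^k`, the bound for all
  -- lower-order terms, at most a quarter of the leading one.
  refine ⟨max 0 (4 * (K + K') / ‖a‖), fun z hz => ?_⟩
  have hz0 : 0 ≤ z.re := (le_max_left _ _).trans hz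
  have hz1 : 4 * (K + K') ≤ z.re * ‖a‖ := by
    rw [← div_le_iff₀ ha']
    exact (le_max_right _ _).trans hz
  set x := Complex.exp z with hx
  have hxn : ‖x‖ = Real.exp z.re := Complex.norm_exp z
  have hx0 : x ≠ 0 := Complex.exp_ne_zero z
  have hx1 : 1 ≤ ‖x‖ := by rw [hxn]; exact Real.one_le_exp hz0
  have hxp : 0 < ‖x‖ := by linarith
  have hxz : z.re ≤ ‖x‖ := by rw [hxn]; linarith [Real.add_one_le_exp z.re]
  have hexp : Complex.exp (((P.natDegree - 1 : ℕ) : ℤ) * z) = x ^ (k + 1) := by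
    rw [hx, ← Complex.exp_nat_mul, hk]
    simp
  have hmain : (K + K') * ‖x‖ ^ k ≤ 1 / 4 * ‖a * x ^ (k + 1)‖ := by
    rw [norm_mul, norm_pow, pow_succ]
    have : 4 * (K + K') ≤ ‖x‖ * ‖a‖ := hz1.trans (by gcongr)
    have := mul_le_mul_of_nonneg_right this (pow_nonneg hxp.le k)
    linarith
  have hq : ‖R.eval x / x‖ ≤ K * ‖x‖ ^ k := by
    rw [norm_div, div_le_iff₀ hxp, mul_assoc, ← pow_succ]
    exact hK x hx1
  have hPx : P.eval x / x = R.eval x / x + a * x ^ (k + 1) := by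
    conv_lhs => rw [hP]
    simp only [Polynomial.eval_add, Polynomial.eval_mul, Polynomial.eval_C, Polynomial.eval_pow,
      Polynomial.eval_X]
    field_simp
    ring
  have hPx' : P.derivative.eval x = (Polynomial.derivative R).eval x
      + a * ((k + 2) * x ^ (k + 1)) := by
    conv_lhs => rw [hP]
    simp only [Polynomial.derivative_add, Polynomial.derivative_C_mul_X_pow, Polynomial.eval_add,
      Polynomial.eval_mul, Polynomial.eval_C, Polynomial.eval_pow, Polynomial.eval_X]
    push_cast
    ring
  unfold IsNearExp
  rw [hexp, (hasDerivAt_expQuotient P z).deriv, ← hx, hPx', hPx, expQuotient, ← hx, hPx, hk]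
  have hp : 0 ≤ ‖x‖ ^ k := by positivity
  constructor
  · rw [add_sub_cancel_right]
    exact hq.trans ((mul_le_mul_of_nonneg_right (le_add_of_nonneg_right hK'0) hp).trans hmain)
  · have : Polynomial.eval x (Polynomial.derivative R) + a * ((k + 2) * x ^ (k + 1)) -
        (Polynomial.eval x R / x + a * x ^ (k + 1)) -
        (((k + 2 - 1 : ℕ) : ℤ) : ℂ) * (a * x ^ (k + 1)) =
        Polynomial.eval x (Polynomial.derivative R) - Polynomial.eval x R / x := by
      simp
      ring
    rw [this]
    refine (norm_sub_le _ _).trans ?_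
    exact (add_le_add (hK' x hx1) hq).trans (le_of_eq_of_le (by ring) hmain)

/-- Writing `P = X·D + P(0)` gives `f = P(0)/x + D(x)` with `x = e^z`, where `D` and `D'` are
bounded on the unit disc. -/
theorem exists_isNearExp_left (P : Polynomial ℂ) (hP0 : P.eval 0 ≠ 0) :
    ∃ X : ℝ, ∀ z : ℂ, z.re ≤ -X → IsNearExp (expQuotient P) (P.eval 0) (-1) z := by
  set D := P.divX with hD
  obtain ⟨K, hK0, hK, -⟩ := D.exists_norm_eval_le le_rfl
  obtain ⟨K', hK'0, hK', -⟩ := (Polynomial.derivative D).exists_norm_eval_le le_rfl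
  set a := P.eval 0 with haa
  have hP : P = D * Polynomial.X + Polynomial.C a := by
    rw [hD, haa, ← Polynomial.coeff_zero_eq_eval_zero, Polynomial.divX_mul_X_add]
  have ha' : 0 < ‖a‖ := norm_pos_iff.2 hP0
  refine ⟨max 0 (4 * (K + K') / ‖a‖), fun z hz => ?_⟩
  have hz0 : 0 ≤ -z.re := (le_max_left _ _).trans (by linarith)
  have hz1 : 4 * (K + K') ≤ -z.re * ‖a‖ := by
    rw [← div_le_iff₀ ha']
    exact (le_max_right _ _).trans (by linarith)
  set x := Complex.exp z with hx
  have hx0 : x ≠ 0 := Complex.exp_ne_zero z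
  have hxn : ‖x‖ = Real.exp z.re := Complex.norm_exp z
  have hx1 : ‖x‖ ≤ 1 := by rw [hxn]; exact Real.exp_le_one_iff.2 (by linarith)
  have hxz : -z.re ≤ ‖x⁻¹‖ := by
    rw [norm_inv, hxn, ← Real.exp_neg]; linarith [Real.add_one_le_exp (-z.re)]
  have hexp : Complex.exp (((-1 : ℤ) : ℂ) * z) = x⁻¹ := by
    rw [hx, ← Complex.exp_neg]
    simp
  have hmain : K + K' ≤ 1 / 4 * ‖a * x⁻¹‖ := by
    rw [norm_mul]
    have : 4 * (K + K') ≤ ‖x⁻¹‖ * ‖a‖ := hz1.trans (by gcongr)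
    linarith
  have hPx : P.eval x / x = D.eval x + a * x⁻¹ := by
    conv_lhs => rw [hP]
    simp
    field_simp
  have hPx' : P.derivative.eval x = (Polynomial.derivative D).eval x * x + D.eval x := by
    conv_lhs => rw [hP]
    simp
  unfold IsNearExp
  rw [hexp, (hasDerivAt_expQuotient P z).deriv, ← hx, hPx', hPx, expQuotient, ← hx, hPx]
  constructor
  · rw [add_sub_cancel_right]
    linarith [hK x hx1]
  · have : Polynomial.eval x (Polynomial.derivative D) * x + Polynomial.eval x D -
        (Polynomial.eval x D + a * x⁻¹) - ((-1 : ℤ) : ℂ) * (a * x⁻¹) =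
        Polynomial.eval x (Polynomial.derivative D) * x := by
      push_cast
      ring
    rw [this, norm_mul]
    have := mul_le_mul (hK' x hx1) hx1 (norm_nonneg _) hK'0
    linarith

/-- `f` grows at most like `e^{d |Re z|}`. -/
theorem exists_norm_expQuotient_le (P : Polynomial ℂ) (hdeg : 1 ≤ P.natDegree) :
    ∃ K : ℝ, 0 ≤ K ∧ ∀ z : ℂ, ‖expQuotient P z‖ ≤ K * Real.exp (P.natDegree * |z.re|) := by
  refine ⟨∑ i ∈ Finset.range (P.natDegree + 1), ‖P.coeff i‖, by positivity, fun z => ?_⟩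
  rw [expQuotient, norm_div, Complex.norm_exp]
  rw [div_le_iff₀ (Real.exp_pos _), mul_assoc, ← Real.exp_add]
  refine (P.norm_eval_le_sum le_rfl _).trans ?_
  rw [Finset.sum_mul]
  refine Finset.sum_le_sum fun i hi => ?_
  refine mul_le_mul_of_nonneg_left ?_ (norm_nonneg _)
  rw [Complex.norm_exp, ← Real.exp_nat_mul, Real.exp_le_exp]
  have hi' : (i : ℝ) ≤ P.natDegree := by
    exact_mod_cast Nat.lt_succ_iff.1 (Finset.mem_range.1 hi)
  have hd : (1 : ℝ) ≤ P.natDegree := by exact_mod_cast hdeg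
  have hi0 : (0 : ℝ) ≤ i := Nat.cast_nonneg i
  rcases abs_cases z.re with ⟨h, h'⟩ | ⟨h, h'⟩ <;> rw [h] <;> nlinarith

/-- The asymptotic behaviour of `f` in the half-planes `|Re z| ≥ X`, for all large `X`. -/
theorem exists_asymptotics (P : Polynomial ℂ) (hdeg : 2 ≤ P.natDegree) (hP0 : P.eval 0 ≠ 0) :
    ∃ X c : ℝ, 0 < c ∧
      (∀ z : ℂ, X ≤ z.re →
        IsNearExp (expQuotient P) P.leadingCoeff (P.natDegree - 1 : ℕ) z) ∧
      (∀ z : ℂ, z.re ≤ -X → IsNearExp (expQuotient P) (P.eval 0) (-1) z) ∧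
      (∀ z : ℂ, X ≤ |z.re| → c * Real.exp |z.re| ≤ ‖expQuotient P z‖ ∧
        ‖expQuotient P z‖ / 2 ≤ ‖deriv (expQuotient P) z‖) := by
  obtain ⟨X₁, h₁⟩ := exists_isNearExp_right P hdeg
  obtain ⟨X₂, h₂⟩ := exists_isNearExp_left P hP0
  have ha : P.leadingCoeff ≠ 0 := by
    rw [Ne, Polynomial.leadingCoeff_eq_zero]
    rintro rfl
    simp at hdeg
  have ha' : 0 < ‖P.leadingCoeff‖ := norm_pos_iff.2 ha
  have hb' : 0 < ‖P.eval 0‖ := norm_pos_iff.2 hP0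
  set X := max 0 (max X₁ X₂) with hX
  have hX0 : 0 ≤ X := le_max_left _ _
  have hX1 : X₁ ≤ X := (le_max_left _ _).trans (le_max_right _ _)
  have hX2 : X₂ ≤ X := (le_max_right _ _).trans (le_max_right _ _)
  have H₁ : ∀ z : ℂ, X ≤ z.re →
      IsNearExp (expQuotient P) P.leadingCoeff (P.natDegree - 1 : ℕ) z :=
    fun z hz => h₁ z (hX1.trans hz)
  have H₂ : ∀ z : ℂ, z.re ≤ -X → IsNearExp (expQuotient P) (P.eval 0) (-1) z :=
    fun z hz => h₂ z (by linarith)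
  set c := 3 / 4 * min ‖P.leadingCoeff‖ ‖P.eval 0‖ with hc
  have hc0 : 0 < c := mul_pos (by norm_num) (lt_min ha' hb')
  refine ⟨X, c, hc0, H₁, H₂, fun z hz => ?_⟩
  rcases le_abs.1 hz with h | h
  · refine ⟨le_trans ?_ (H₁ z h).norm_lower, (H₁ z h).half_norm_le ?_⟩
    · have h1 : (1 : ℝ) ≤ (P.natDegree - 1 : ℕ) := by exact_mod_cast (by omega)
      have h2 : ((((P.natDegree - 1 : ℕ) : ℤ) : ℂ) * z).re = (P.natDegree - 1 : ℕ) * z.re := by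
        simp only [Int.cast_natCast, Complex.mul_re, Complex.natCast_re, Complex.natCast_im]
        ring
      rw [abs_of_nonneg (hX0.trans h), norm_mul, Complex.norm_exp, hc, mul_assoc, h2]
      exact mul_le_mul_of_nonneg_left (mul_le_mul (min_le_left _ _)
        (Real.exp_le_exp.2 (le_mul_of_one_le_left (hX0.trans h) h1)) (Real.exp_pos _).le
        (norm_nonneg _)) (by norm_num)
    · have : P.natDegree - 1 ≠ 0 := by omega
      exact_mod_cast this
  · have h' : z.re ≤ -X := by linarith
    refine ⟨le_trans ?_ (H₂ z h').norm_lower, (H₂ z h').half_norm_le (by norm_num)⟩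
    rw [abs_of_nonpos (by linarith), norm_mul, Complex.norm_exp, hc, mul_assoc]
    gcongr
    · exact min_le_right _ _
    · simp

/-! ### Escaping points lie in the Julia set -/

/-- Where `f` is close to `a e^{mz}`, its real part takes both signs on every set whose projection
to the imaginary axis contains an interval of length `2π`. -/
theorem IsNearExp.abs_im_sub_le {f : ℂ → ℂ} (hf : Continuous f) {a : ℂ} (ha : a ≠ 0) {m : ℤ}
    (hm : m ≠ 0) {V : Set ℂ} (hV : IsPreconnected V) (h : ∀ w ∈ V, IsNearExp f a m w)
    (hre : ∀ w ∈ V, (f w).re ≠ 0) {w₁ w₂ : ℂ} (h₁ : w₁ ∈ V) (h₂ : w₂ ∈ V) :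
    w₁.im - w₂.im ≤ 2 * Real.pi := by
  by_contra! hlt
  have hm' : (m : ℝ) ≠ 0 := by exact_mod_cast hm
  have key : ∀ θ : ℝ, ∃ w ∈ V, ∃ s : ℝ, 0 < s ∧
      a * Complex.exp (m * w) = s * Complex.exp (θ * Complex.I) := by
    intro θ
    -- A height congruent to `(θ - arg a)/m` mod `2π` gives `a e^{mw}` the argument `θ`, because `m`
    -- is an integer; `θ = 0` and `θ = π` then yield both signs.
    obtain ⟨k, hk, -⟩ := existsUnique_add_zsmul_mem_Ico Real.two_pi_pos ((θ - a.arg) / m) w₂.im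
    obtain ⟨w, hw, hwim⟩ : (θ - a.arg) / m + k • (2 * Real.pi) ∈ Complex.im '' V := by
      refine (hV.image _ Complex.continuous_im.continuousOn).Icc_subset
        (Set.mem_image_of_mem _ h₂) (Set.mem_image_of_mem _ h₁) ⟨hk.1, ?_⟩
      linarith [hk.2]
    refine ⟨w, hw, ‖a‖ * Real.exp (m * w.re), by positivity, ?_⟩
    have hmw : (m : ℝ) * w.im = θ - a.arg + ((m * k : ℤ) : ℝ) * (2 * Real.pi) := by
      rw [hwim, mul_add, mul_div_cancel₀ _ hm']
      simp
      ring
    conv_lhs => rw [← Complex.norm_mul_exp_arg_mul_I a, ← Complex.re_add_im w]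
    push_cast
    rw [mul_assoc, mul_assoc, ← Complex.exp_add, ← Complex.exp_add]
    congr 1
    rw [Complex.exp_eq_exp_iff_exists_int]
    refine ⟨m * k, ?_⟩
    have hmw' : (m : ℂ) * w.im = θ - a.arg + ((m * k : ℤ) : ℂ) * (2 * Real.pi) := by
      exact_mod_cast hmw
    linear_combination Complex.I * hmw'
  have hpos : ∃ w ∈ V, 0 < (f w).re := by
    obtain ⟨w, hw, s, hs, hws⟩ := key 0
    refine ⟨w, hw, ?_⟩
    have h1 := (h w hw).1
    simp only [Complex.ofReal_zero, zero_mul, Complex.exp_zero, mul_one] at hws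
    rw [hws, Complex.norm_real, Real.norm_of_nonneg hs.le] at h1
    have h2 := (abs_le.1 ((Complex.abs_re_le_norm _).trans h1)).1
    simp at h2
    linarith
  have hneg : ∃ w ∈ V, (f w).re < 0 := by
    obtain ⟨w, hw, s, hs, hws⟩ := key Real.pi
    refine ⟨w, hw, ?_⟩
    have h1 := (h w hw).1
    rw [Complex.exp_pi_mul_I] at hws
    rw [hws, norm_mul, Complex.norm_real, Real.norm_of_nonneg hs.le] at h1
    have h2 := (abs_le.1 ((Complex.abs_re_le_norm _).trans h1)).2
    simp at h2
    linarith
  obtain ⟨u, hu, hu0⟩ := hpos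
  obtain ⟨v, hv, hv0⟩ := hneg
  obtain ⟨w, hw, hw0⟩ := (hV.image (fun w => (f w).re)
    (Complex.continuous_re.comp hf).continuousOn).Icc_subset
    (Set.mem_image_of_mem _ hv) (Set.mem_image_of_mem _ hu) ⟨hv0.le, hu0.le⟩
  exact hre w hw hw0

/-- A holomorphic function on a disc whose imaginary part deviates by at most `B` from its value
at the centre has a bounded derivative at the centre. -/
theorem norm_deriv_le_of_im_bounded {g : ℂ → ℂ} (hg : Differentiable ℂ g) {c : ℂ} {r B : ℝ}
    (hr : 0 < r) (h : ∀ z ∈ Metric.closedBall c r, (g c).im - (g z).im ≤ B) :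
    ‖deriv g c‖ ≤ Real.exp B / r := by
  -- `|G| = exp(Im g(c) - Im g)` is at most `e^B` and `|G'(c)| = |g'(c)|`, so Cauchy's estimate for
  -- `G` suffices.
  set G : ℂ → ℂ := fun z => Complex.exp (Complex.I * (g z - g c)) with hG
  have hd : ∀ z, HasDerivAt G (G z * (Complex.I * deriv g z)) z := fun z =>
    (((hg z).hasDerivAt.sub_const (g c)).const_mul Complex.I).cexp
  have hGd : Differentiable ℂ G := fun z => (hd z).differentiableAt
  have h1 := Complex.norm_deriv_le_of_forall_mem_sphere_norm_le (C := Real.exp B) hr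
    (hGd.diffContOnCl (s := Metric.ball c r)) (fun z hz => by
      rw [hG]
      simp only [Complex.norm_exp]
      rw [Real.exp_le_exp]
      have := h z (Metric.sphere_subset_closedBall hz)
      simp
      linarith)
  rw [(hd c).deriv] at h1
  simpa [hG] using h1

theorem Function.Surjective.iterate_not_const {f : ℂ → ℂ} (hf : Function.Surjective f) (n : ℕ)
    (w : ℂ) : ∃ z, f^[n] z ≠ w := by
  obtain ⟨z, hz⟩ := hf.iterate n (w + 1)
  exact ⟨z, by rw [hz]; simp⟩

/-- The equation `P(x) = wx` has a root, nonzero because `P(0) ≠ 0`, hence an exponential. -/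
theorem expQuotient_surjective (P : Polynomial ℂ) (hdeg : 2 ≤ P.natDegree) (hP0 : P.eval 0 ≠ 0) :
    Function.Surjective (expQuotient P) := by
  intro w
  have hdeg' : (P - Polynomial.C w * Polynomial.X).degree ≠ 0 := by
    have h1 : (Polynomial.C w * Polynomial.X).degree < P.degree := by
      refine (Polynomial.degree_C_mul_X_le w).trans_lt ?_
      rw [Polynomial.degree_eq_natDegree (by rintro rfl; simp at hP0)]
      exact_mod_cast hdeg
    rw [Polynomial.degree_sub_eq_left_of_degree_lt h1,
      Polynomial.degree_eq_natDegree (by rintro rfl; simp at hP0)]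
    exact_mod_cast (by omega)
  obtain ⟨x, hx⟩ := IsAlgClosed.exists_root _ hdeg'
  have hx0 : x ≠ 0 := by
    rintro rfl
    simp at hx
    exact hP0 (by simpa using hx)
  refine ⟨Complex.log x, ?_⟩
  rw [expQuotient, Complex.exp_log hx0, div_eq_iff hx0]
  simpa [sub_eq_zero] using hx

theorem deriv_iterate_succ {f : ℂ → ℂ} (hf : Differentiable ℂ f) (n : ℕ) (z : ℂ) :
    deriv f^[n + 1] z = deriv f (f^[n] z) * deriv f^[n] z := by
  rw [Function.iterate_succ']
  exact deriv_comp z (hf _) (hf.iterate n z)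

theorem norm_deriv_iterate_ge {f : ℂ → ℂ} (hf : Differentiable ℂ f) {z : ℂ}
    (h : ∀ n, 2 ≤ ‖deriv f (f^[n] z)‖) (n : ℕ) : 2 ^ n ≤ ‖deriv f^[n] z‖ := by
  induction n with
  | zero => simp
  | succ n ih =>
    rw [deriv_iterate_succ hf, norm_mul, pow_succ']
    exact mul_le_mul (h n) ih (by positivity) (norm_nonneg _)

/-- No open set has all its iterates in the domain where `|f|` is large. -/
theorem exists_no_open_large (P : Polynomial ℂ) (hdeg : 2 ≤ P.natDegree) (hP0 : P.eval 0 ≠ 0) :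
    ∃ C : ℝ, ∀ V : Set ℂ, IsOpen V → V.Nonempty →
      ¬ ∀ n : ℕ, ∀ w ∈ V, C ≤ ‖(expQuotient P)^[n] w‖ := by
  obtain ⟨X, c, hc, hR, hL, hlow⟩ := exists_asymptotics P hdeg hP0
  obtain ⟨K, hK0, hK⟩ := exists_norm_expQuotient_le P (by omega)
  set f := expQuotient P with hf
  have hfd : Differentiable ℂ f := differentiable_expQuotient P
  have ha : P.leadingCoeff ≠ 0 := by
    rw [Ne, Polynomial.leadingCoeff_eq_zero]
    rintro rfl
    simp at hP0
  set Y := max 1 X with hY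
  -- The second entry exceeds `|f|` on `|Re z| ≤ Y`, so every iterate stays outside that strip; the
  -- `4` gives `|f'| ≥ |f|/2 ≥ 2` along orbits.
  refine ⟨max 4 (K * Real.exp (P.natDegree * Y) + 1), ?_⟩
  rintro V hVo ⟨w₀, hw₀⟩ hV
  have hbig : ∀ n : ℕ, ∀ w ∈ V, Y < |(f^[n] w).re| := by
    intro n w hw
    by_contra! hle
    have h1 := hV (n + 1) w hw
    rw [Function.iterate_succ_apply'] at h1
    have h2 := (hK (f^[n] w)).trans (mul_le_mul_of_nonneg_left (Real.exp_le_exp.2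
      (mul_le_mul_of_nonneg_left hle (Nat.cast_nonneg _))) hK0)
    linarith [(le_max_right _ _).trans h1]
  have hder : ∀ n, 2 ≤ ‖deriv f (f^[n] w₀)‖ := by
    intro n
    have h1 := (hlow _ (((le_max_right _ _).trans_lt (hbig n w₀ hw₀)).le)).2
    have h2 := hV (n + 1) w₀ hw₀
    rw [Function.iterate_succ_apply'] at h2
    linarith [(le_max_left _ _).trans h2]
  obtain ⟨r, hr, hrV⟩ := Metric.nhds_basis_closedBall.mem_iff.1 (hVo.mem_nhds hw₀)
  have hosc : ∀ n, ∀ z ∈ Metric.closedBall w₀ r,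
      (f^[n] w₀).im - (f^[n] z).im ≤ 2 * Real.pi := by
    intro n z hz
    have hcon : IsPreconnected (f^[n] '' Metric.closedBall w₀ r) :=
      (convex_closedBall w₀ r).isPreconnected.image _ (hfd.continuous.iterate n).continuousOn
    have hm₀ : f^[n] w₀ ∈ f^[n] '' Metric.closedBall w₀ r :=
      Set.mem_image_of_mem _ (Metric.mem_closedBall_self hr.le)
    have hm₁ := Set.mem_image_of_mem f^[n] hz
    have hre : ∀ w ∈ f^[n] '' Metric.closedBall w₀ r, (f w).re ≠ 0 := by
      rintro _ ⟨u, hu, rfl⟩ h0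
      have h1 := hbig (n + 1) u (hrV hu)
      rw [Function.iterate_succ_apply', h0, abs_zero] at h1
      linarith [le_max_left 1 X]
    have hout : ∀ w ∈ f^[n] '' Metric.closedBall w₀ r, Y < |w.re| := by
      rintro _ ⟨u, hu, rfl⟩
      exact hbig n u (hrV hu)
    have hside : (∀ w ∈ f^[n] '' Metric.closedBall w₀ r, X ≤ w.re) ∨
        (∀ w ∈ f^[n] '' Metric.closedBall w₀ r, w.re ≤ -X) := by
      by_contra! hcon'
      obtain ⟨⟨u, hu, hu'⟩, v, hv, hv'⟩ := hcon'
      have hXY : X ≤ Y := le_max_right _ _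
      have h1Y : 1 ≤ Y := le_max_left _ _
      have hu1 : u.re ≤ 0 := by
        rcases lt_abs.1 (hout u hu) with h | h <;> linarith
      have hv1 : 0 ≤ v.re := by
        rcases lt_abs.1 (hout v hv) with h | h <;> linarith
      obtain ⟨w, hw, hw0⟩ := (hcon.image _ Complex.continuous_re.continuousOn).Icc_subset
        (Set.mem_image_of_mem _ hu) (Set.mem_image_of_mem _ hv) ⟨hu1, hv1⟩
      have := hout w hw
      rw [hw0, abs_zero] at this
      linarith
    rcases hside with hs | hs
    · have hm : ((P.natDegree - 1 : ℕ) : ℤ) ≠ 0 := by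
        have : P.natDegree - 1 ≠ 0 := by omega
        exact_mod_cast this
      exact IsNearExp.abs_im_sub_le hfd.continuous ha hm hcon (fun w hw => hR w (hs w hw)) hre
        hm₀ hm₁
    · exact IsNearExp.abs_im_sub_le hfd.continuous hP0 (by norm_num) hcon
        (fun w hw => hL w (hs w hw)) hre hm₀ hm₁
  obtain ⟨n, hn⟩ := pow_unbounded_of_one_lt (Real.exp (2 * Real.pi) / r) one_lt_two
  have h1 := norm_deriv_le_of_im_bounded (hfd.iterate n) hr (hosc n)
  linarith [norm_deriv_iterate_ge hfd hder n]

theorem escaping_subset_juliaSet (P : Polynomial ℂ) (hdeg : 2 ≤ P.natDegree)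
    (hP0 : P.eval 0 ≠ 0) {z : ℂ}
    (hz : Tendsto (fun n => ‖(expQuotient P)^[n] z‖) atTop atTop) :
    z ∈ juliaSet (expQuotient P) := by
  obtain ⟨C, hC⟩ := exists_no_open_large P hdeg hP0
  have hfd := differentiable_expQuotient P
  have hsurj := expQuotient_surjective P hdeg hP0
  set f := expQuotient P with hf
  rintro ⟨U, ⟨hUo, -, hU⟩, hzU⟩
  obtain ⟨r, hr, hrU⟩ := Metric.nhds_basis_closedBall.mem_iff.1 (hUo.mem_nhds hzU)
  -- Otherwise a sequence of exceptional iterates has a convergent subsequence; a finite limit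
  -- contradicts escape at `z`, an infinite one contradicts exceptionality.
  have hev : ∀ᶠ n in atTop, ∀ w ∈ Metric.closedBall z r, C ≤ ‖f^[n] w‖ := by
    by_contra hne
    obtain ⟨ψ, hψ, hψ'⟩ := extraction_of_frequently_atTop (not_eventually.1 hne)
    obtain ⟨φ, hφ, hlim | hlim⟩ := hU (fun k => f^[ψ k]) fun k => ⟨ψ k, rfl⟩
    · obtain ⟨h, -, hh⟩ := hlim
      have h1 := (hh.tendsto_at hzU).norm
      have h2 := hz.comp ((hψ.comp hφ).tendsto_atTop)
      exact not_tendsto_nhds_of_tendsto_atTop h2 _ h1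
    · obtain ⟨k, hk⟩ := (hlim _ hrU (isCompact_closedBall z r) C).exists
      exact hψ' (φ k) hk
  obtain ⟨N, hN⟩ := eventually_atTop.1 hev
  have hopen : IsOpen (f^[N] '' Metric.ball z r) := by
    have han : AnalyticOnNhd ℂ f^[N] Set.univ :=
      (hfd.iterate N).differentiableOn.analyticOnNhd isOpen_univ
    rcases han.is_constant_or_isOpen isPreconnected_univ with ⟨w, hw⟩ | h
    · obtain ⟨u, hu⟩ := hsurj.iterate_not_const N w
      exact absurd (hw u trivial) hu
    · exact h _ (Set.subset_univ _) Metric.isOpen_ball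
  refine hC _ hopen ⟨_, Set.mem_image_of_mem _ (Metric.mem_ball_self hr)⟩ ?_
  rintro n _ ⟨w, hw, rfl⟩
  rw [← Function.iterate_add_apply]
  exact hN _ (Nat.le_add_left _ _) w (Metric.ball_subset_closedBall hw)

theorem fastEscapingSet_subset_juliaSet (P : Polynomial ℂ) (hdeg : 2 ≤ P.natDegree)
    (hP0 : P.eval 0 ≠ 0) {R : ℝ} (hR : IsFastRadius (expQuotient P) R) :
    fastEscapingSet (expQuotient P) R ⊆ juliaSet (expQuotient P) := by
  rintro z ⟨ℓ, hℓ⟩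
  refine escaping_subset_juliaSet P hdeg hP0 ?_
  rw [← tendsto_add_atTop_iff_nat ℓ]
  exact tendsto_atTop_mono hℓ hR.2

/-! ### Change of variables with multiplicity -/

theorem abs_det_restrictScalars_fderiv (f : ℂ → ℂ) (z : ℂ) :
    |((fderiv ℂ f z).restrictScalars ℝ).det| = ‖deriv f z‖ ^ 2 := by
  have h1 : ((fderiv ℂ f z).restrictScalars ℝ).det =
      LinearMap.det ((fderiv ℂ f z : ℂ →ₗ[ℂ] ℂ).restrictScalars ℝ) := rfl
  rw [h1, LinearMap.det_restrictScalars, LinearMap.det_ring, Algebra.norm_complex_apply,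
    Complex.normSq_eq_norm_sq, abs_of_nonneg (by positivity)]
  simp

/-- The change of variables formula for a holomorphic map of multiplicity at most `N`. -/
theorem lintegral_norm_deriv_sq_mul_comp_le {f : ℂ → ℂ} (hf : Differentiable ℂ f) {s : Set ℂ}
    (hs : MeasurableSet s) (h0 : ∀ z ∈ s, deriv f z ≠ 0) {N : ℕ}
    (hN : ∀ w, {z ∈ s | f z = w}.encard ≤ N) {g : ℂ → ENNReal} (hg : Measurable g) :
    ∫⁻ z in s, ENNReal.ofReal (‖deriv f z‖ ^ 2) * g (f z) ≤ N * ∫⁻ w, g w := by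
  rcases s.eq_empty_or_nonempty with rfl | hne
  · simp
  set f' : ℂ → ℂ →L[ℝ] ℂ := fun z => (fderiv ℂ f z).restrictScalars ℝ with hf'
  have hder : ∀ z ∈ s, HasFDerivWithinAt f (f' z) s z := fun z _ =>
    ((hf z).hasFDerivAt.restrictScalars ℝ).hasFDerivWithinAt
  obtain ⟨t, A, htd, htm, hst, happ, hA⟩ :=
    exists_partition_approximatesLinearOn_of_hasFDerivWithinAt f s f' hder
      (fun A => if ‖A 1‖₊ = 0 then 1 else ‖A 1‖₊ / 2) (fun A => by
        split_ifs with h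
        · exact one_ne_zero
        · exact div_ne_zero h two_ne_zero)
  have hinj : ∀ n, Set.InjOn f (s ∩ t n) := by
    intro n x hx y hy hxy
    obtain ⟨u, hu, hAu⟩ := hA hne n
    have hAv : ∀ v, A n v = v * deriv f u := by
      intro v
      rw [hAu, hf']
      simp
    have h1 := happ n x hx y hy
    have hu0 := norm_pos_iff.2 (h0 u hu)
    have hne1 : ‖A n 1‖₊ ≠ 0 := by
      rw [hAv, one_mul]
      simpa using h0 u hu
    rw [if_neg hne1, hxy, sub_self, zero_sub, norm_neg, hAv, norm_mul] at h1
    simp only [hAv, one_mul, NNReal.coe_div, coe_nnnorm, NNReal.coe_ofNat] at h1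
    by_contra hne'
    have := norm_pos_iff.2 (sub_ne_zero.2 hne')
    nlinarith [mul_pos this hu0]
  have hsm : ∀ n, MeasurableSet (s ∩ t n) := fun n => hs.inter (htm n)
  have himm : ∀ n, MeasurableSet (f '' (s ∩ t n)) := fun n =>
    (hsm n).image_of_continuousOn_injOn hf.continuous.continuousOn (hinj n)
  have hdisj : Pairwise (Function.onFun Disjoint fun n => s ∩ t n) := fun i j hij =>
    (htd hij).mono Set.inter_subset_right Set.inter_subset_right
  have hsU : s = ⋃ n, s ∩ t n := by
    rw [← Set.inter_iUnion, Set.inter_eq_left.2 hst]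
  -- The pieces are disjoint, so those whose images contain `w` contribute distinct preimages of
  -- `w`: at most `N`.
  have hpt : ∀ w, ∑' n, (f '' (s ∩ t n)).indicator g w ≤ N * g w := by
    intro w
    rw [ENNReal.tsum_eq_iSup_sum]
    refine iSup_le fun F => ?_
    classical
    have hsum : ∑ n ∈ F, (f '' (s ∩ t n)).indicator g w =
        ((F.filter fun n => w ∈ f '' (s ∩ t n)).card : ENNReal) * g w := by
      simp only [Set.indicator_apply]
      rw [← Finset.sum_filter, Finset.sum_const, nsmul_eq_mul]
    rw [hsum]
    gcongr
    have hex : ∀ n, ∃ z, w ∈ f '' (s ∩ t n) → z ∈ s ∩ t n ∧ f z = w := by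
      intro n
      by_cases h : w ∈ f '' (s ∩ t n)
      · obtain ⟨z, hz, hzw⟩ := h
        exact ⟨z, fun _ => ⟨hz, hzw⟩⟩
      · exact ⟨0, fun h' => absurd h' h⟩
    choose ζ hζ using hex
    set G := F.filter fun n => w ∈ f '' (s ∩ t n) with hG
    have hGm : ∀ n ∈ G, ζ n ∈ s ∩ t n ∧ f (ζ n) = w := fun n hn =>
      hζ n (Finset.mem_filter.1 hn).2
    have hζinj : Set.InjOn ζ G := by
      intro i hi j hj hij
      by_contra hne'
      exact Set.disjoint_left.1 (htd hne') (hGm i hi).1.2 (hij ▸ (hGm j hj).1.2)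
    have h1 : ((G.image ζ : Finset ℂ) : Set ℂ) ⊆ {z ∈ s | f z = w} := by
      intro z hz
      obtain ⟨n, hn, rfl⟩ := Finset.mem_image.1 (Finset.mem_coe.1 hz)
      exact ⟨(hGm n hn).1.1, (hGm n hn).2⟩
    have h2 := (Set.encard_le_encard h1).trans (hN w)
    rw [Set.encard_coe_eq_coe_finsetCard, Finset.card_image_of_injOn hζinj] at h2
    exact_mod_cast h2
  calc ∫⁻ z in s, ENNReal.ofReal (‖deriv f z‖ ^ 2) * g (f z)
      = ∑' n, ∫⁻ z in s ∩ t n, ENNReal.ofReal (‖deriv f z‖ ^ 2) * g (f z) := by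
        conv_lhs => rw [hsU]
        exact lintegral_iUnion hsm hdisj _
    _ = ∑' n, ∫⁻ w, (f '' (s ∩ t n)).indicator g w := by
        refine tsum_congr fun n => ?_
        rw [lintegral_indicator (himm n), lintegral_image_eq_lintegral_abs_det_fderiv_mul volume
          (hsm n) (fun z hz => (hder z hz.1).mono Set.inter_subset_left) (hinj n)]
        simp only [hf', abs_det_restrictScalars_fderiv]
    _ = ∫⁻ w, ∑' n, (f '' (s ∩ t n)).indicator g w :=
        (lintegral_tsum fun n => (hg.indicator (himm n)).aemeasurable).symm
    _ ≤ ∫⁻ w, N * g w := lintegral_mono hpt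
    _ = N * ∫⁻ w, g w := lintegral_const_mul _ hg

/-! ### Periodicity and integrals of `|w|⁻²` -/

/-- The half-open horizontal strip of width `2π`, a fundamental domain for translation by `2πi`. -/
def halfOpenStrip (a : ℝ) : Set ℂ := {z | a ≤ z.im ∧ z.im < a + 2 * Real.pi}

theorem mem_halfOpenStrip {a : ℝ} {z : ℂ} :
    z ∈ halfOpenStrip a ↔ a ≤ z.im ∧ z.im < a + 2 * Real.pi := Iff.rfl

theorem measurableSet_halfOpenStrip (a : ℝ) : MeasurableSet (halfOpenStrip a) :=
  (measurableSet_le measurable_const Complex.measurable_im).inter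
    (measurableSet_lt Complex.measurable_im measurable_const)

theorem injOn_exp_halfOpenStrip (a : ℝ) : Set.InjOn Complex.exp (halfOpenStrip a) := by
  rintro x ⟨hx1, hx2⟩ y ⟨hy1, hy2⟩ hxy
  obtain ⟨n, hn⟩ := Complex.exp_eq_exp_iff_exists_int.1 hxy
  have him : x.im = y.im + n * (2 * Real.pi) := by
    rw [hn]
    simp
  have hpi := Real.two_pi_pos
  have h1 : (n : ℝ) < 1 := by
    by_contra! h
    nlinarith
  have h2 : (-1 : ℝ) < n := by
    by_contra! h
    nlinarith
  have h3 : n = 0 := by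
    have : n < 1 := by exact_mod_cast h1
    have : -1 < n := by exact_mod_cast h2
    omega
  rw [hn, h3]
  simp

/-- The exponential is injective on the strip and sends solutions to roots of `P - wX`, whose degree
is that of `P`. -/
theorem encard_preimage_expQuotient_le (P : Polynomial ℂ) (hdeg : 2 ≤ P.natDegree) (a : ℝ)
    (w : ℂ) : {z ∈ halfOpenStrip a | expQuotient P z = w}.encard ≤ P.natDegree := by
  set Q := P - Polynomial.C w * Polynomial.X with hQ
  have hlt : (Polynomial.C w * Polynomial.X).natDegree < P.natDegree :=
    (Polynomial.natDegree_C_mul_le _ _).trans_lt (by rw [Polynomial.natDegree_X]; omega)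
  have hQd : Q.natDegree = P.natDegree := Polynomial.natDegree_sub_eq_left_of_natDegree_lt hlt
  have hQ0 : Q ≠ 0 := by
    intro h
    rw [h, Polynomial.natDegree_zero] at hQd
    omega
  have hinj : Set.InjOn Complex.exp {z ∈ halfOpenStrip a | expQuotient P z = w} :=
    (injOn_exp_halfOpenStrip a).mono fun z hz => hz.1
  have hsub : Complex.exp '' {z ∈ halfOpenStrip a | expQuotient P z = w} ⊆
      (Q.roots.toFinset : Set ℂ) := by
    rintro _ ⟨z, ⟨-, hz⟩, rfl⟩
    rw [expQuotient, div_eq_iff (Complex.exp_ne_zero z)] at hz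
    simp [hQ, hz]
    exact fun h => hQ0 h
  rw [← hinj.encard_image]
  refine (Set.encard_le_encard hsub).trans ?_
  rw [Set.encard_coe_eq_coe_finsetCard, ← hQd]
  exact_mod_cast (Multiset.toFinset_card_le _).trans (Polynomial.card_roots' Q)

/-- Unfolding an integral over a `2πi`-periodic set. -/
theorem setLIntegral_le_tsum_translate {B : Set ℂ} (hB : MeasurableSet B)
    (hper : ∀ (j : ℤ) (z : ℂ), z + j * (2 * Real.pi * Complex.I) ∈ B ↔ z ∈ B)
    (a : ℝ) (h : ℂ → ENNReal) :
    ∫⁻ w in B, h w ≤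
      ∑' j : ℤ, ∫⁻ w in halfOpenStrip a ∩ B, h (w + j * (2 * Real.pi * Complex.I)) := by
  have hcov : B ⊆ ⋃ j : ℤ, halfOpenStrip (a + j * (2 * Real.pi)) ∩ B := by
    intro z hz
    obtain ⟨k, hk, -⟩ := existsUnique_add_zsmul_mem_Ico Real.two_pi_pos z.im a
    refine Set.mem_iUnion.2 ⟨-k, ⟨?_, ?_⟩, hz⟩
    · have := hk.1
      simp at this ⊢
      linarith
    · have := hk.2
      simp at this ⊢
      linarith
  refine (lintegral_mono_set hcov).trans ((lintegral_iUnion_le _ _).trans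
    (ENNReal.tsum_le_tsum fun j => le_of_eq ?_))
  rw [← lintegral_indicator ((measurableSet_halfOpenStrip _).inter hB),
    ← lintegral_indicator ((measurableSet_halfOpenStrip _).inter hB),
    ← lintegral_add_right_eq_self _ ((j : ℂ) * (2 * Real.pi * Complex.I))]
  refine lintegral_congr fun z => ?_
  have hiff : z + j * (2 * Real.pi * Complex.I) ∈ halfOpenStrip (a + j * (2 * Real.pi)) ∩ B ↔
      z ∈ halfOpenStrip a ∩ B := by
    refine and_congr ?_ (hper j z)
    have him : (z + j * (2 * Real.pi * Complex.I)).im = z.im + j * (2 * Real.pi) := by simp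
    rw [mem_halfOpenStrip, mem_halfOpenStrip, him]
    constructor <;> rintro ⟨h1, h2⟩ <;> constructor <;> linarith
  by_cases hz : z ∈ halfOpenStrip a ∩ B
  · rw [Set.indicator_of_mem (hiff.2 hz), Set.indicator_of_mem hz]
  · rw [Set.indicator_of_notMem (mt hiff.1 hz), Set.indicator_of_notMem hz]

/-- On the `j`-th translate of the strip `-π ≤ Im z < π`, `|Im w| ≥ |j|`, hence `|w|² ≥ X² + j²`. -/
theorem setLIntegral_inv_norm_sq_le {B : Set ℂ} (hB : MeasurableSet B)
    (hper : ∀ (j : ℤ) (z : ℂ), z + j * (2 * Real.pi * Complex.I) ∈ B ↔ z ∈ B)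
    {X : ℝ} (hX : 0 < X) (hBX : ∀ z ∈ B, X ≤ |z.re|) :
    ∫⁻ w in B, ENNReal.ofReal (4 / ‖w‖ ^ 2) ≤
      (∑' j : ℤ, ENNReal.ofReal (4 / (X ^ 2 + (j : ℝ) ^ 2))) *
        volume (halfOpenStrip (-Real.pi) ∩ B) := by
  refine (setLIntegral_le_tsum_translate hB hper (-Real.pi) _).trans ?_
  rw [← ENNReal.tsum_mul_right]
  refine ENNReal.tsum_le_tsum fun j => ?_
  rw [← setLIntegral_const]
  refine setLIntegral_mono' ((measurableSet_halfOpenStrip _).inter hB) fun z hz => ?_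
  apply ENNReal.ofReal_le_ofReal
  have hre : (z + j * (2 * Real.pi * Complex.I)).re = z.re := by simp
  have him : (z + j * (2 * Real.pi * Complex.I)).im = z.im + j * (2 * Real.pi) := by simp
  have h1 : X ^ 2 ≤ z.re ^ 2 := by
    rw [← sq_abs z.re]
    exact pow_le_pow_left₀ hX.le (hBX z hz.2) 2
  have h2 : (j : ℝ) ^ 2 ≤ (z.im + j * (2 * Real.pi)) ^ 2 := by
    obtain ⟨hl, hu⟩ := hz.1
    have hpi := Real.pi_gt_three
    rcases lt_trichotomy j 0 with hj | hj | hj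
    · have hj' : (j : ℝ) ≤ -1 := by exact_mod_cast (by omega : j ≤ -1)
      have : z.im + j * (2 * Real.pi) ≤ j := by nlinarith
      nlinarith
    · subst hj
      simp
      positivity
    · have hj' : (1 : ℝ) ≤ j := by exact_mod_cast (by omega : 1 ≤ j)
      have : (j : ℝ) ≤ z.im + j * (2 * Real.pi) := by nlinarith
      nlinarith
  have h3 : ‖z + j * (2 * Real.pi * Complex.I)‖ ^ 2 = z.re ^ 2 + (z.im + j * (2 * Real.pi)) ^ 2 := by
    rw [← Complex.normSq_eq_norm_sq, Complex.normSq_apply, hre, him]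
    ring
  rw [h3]
  exact div_le_div_of_nonneg_left (by norm_num) (by positivity) (by linarith)

theorem exists_tsum_inv_sq_add_sq_le {ε : ENNReal} (hε : ε ≠ 0) :
    ∃ X₀ : ℝ, ∀ X ≥ X₀, ∑' j : ℤ, ENNReal.ofReal (4 / (X ^ 2 + (j : ℝ) ^ 2)) ≤ ε := by
  have hsum : Summable fun j : ℤ => 4 / (1 + (j : ℝ) ^ 2) := by
    have h1 : Summable fun j : ℤ => 4 * (1 / (j : ℝ) ^ 2) :=
      (Real.summable_one_div_int_pow.2 one_lt_two).mul_left 4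
    -- The term `j = 0` needs its own majorant, since `1 / 0 = 0`.
    have h2 : Summable fun j : ℤ => if j = 0 then (4 : ℝ) else 0 := (hasSum_ite_eq 0 4).summable
    refine Summable.of_nonneg_of_le (fun j => by positivity) (fun j => ?_) (h1.add h2)
    by_cases hj : j = 0
    · simp [hj]
    · have hj' : (0 : ℝ) < (j : ℝ) ^ 2 := by positivity
      simp only [hj, if_false, add_zero, mul_one_div]
      exact div_le_div_of_nonneg_left (by norm_num) hj' (by linarith)
  have hlim : Tendsto (fun X : ℝ => ∑' j : ℤ, 4 / (X ^ 2 + (j : ℝ) ^ 2)) atTop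
      (𝓝 (∑' _ : ℤ, 0)) := by
    refine tendsto_tsum_of_dominated_convergence hsum (fun j => ?_) ?_
    · exact tendsto_const_nhds.div_atTop
        (tendsto_atTop_add_const_right _ _ (tendsto_pow_atTop two_ne_zero))
    · filter_upwards [eventually_ge_atTop 1] with X hX j
      rw [Real.norm_of_nonneg (by positivity)]
      exact div_le_div_of_nonneg_left (by norm_num) (by positivity) (by nlinarith)
  have hlim' := (ENNReal.continuous_ofReal.tendsto _).comp hlim
  rw [tsum_zero, ENNReal.ofReal_zero] at hlim'
  obtain ⟨X₀, hX₀⟩ := eventually_atTop.1 ((hlim'.eventually_le_const (pos_iff_ne_zero.2 hε)).and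
    (eventually_ge_atTop 1))
  refine ⟨X₀, fun X hX => ?_⟩
  obtain ⟨h1, h2⟩ := hX₀ X hX
  rw [← ENNReal.ofReal_tsum_of_nonneg (fun j => by positivity)]
  · exact h1
  · refine Summable.of_nonneg_of_le (fun j => by positivity) (fun j => ?_) hsum
    exact div_le_div_of_nonneg_left (by norm_num) (by positivity) (by nlinarith)

theorem integrable_inv_rpow_im_mul_re :
    Integrable fun w : ℂ => (1 + ‖w.re‖) ^ (-(3 / 2 : ℝ)) * (1 + ‖w.im‖) ^ (-(5 / 4 : ℝ)) := by
  have h1 : Integrable fun x : ℝ => (1 + ‖x‖) ^ (-(3 / 2 : ℝ)) :=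
    integrable_one_add_norm (by simp; norm_num)
  have h2 : Integrable fun x : ℝ => (1 + ‖x‖) ^ (-(5 / 4 : ℝ)) :=
    integrable_one_add_norm (by simp; norm_num)
  exact (Complex.volume_preserving_equiv_real_prod.integrable_comp_emb
    Complex.measurableEquivRealProd.measurableEmbedding).2 (h1.mul_prod h2)

/-- Here `(1 + |Re w|)²` and `1 + |Im w|` are both `O(|w|)`. Splitting `|w|⁻² = |w|^{-3/4}
|w|^{-5/4}` gives the product majorant with exponents `3/2` and `5/4`, both above `1`. -/
theorem setLIntegral_inv_norm_sq_lt_top {c : ℝ} (hc : 0 < c) :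
    ∫⁻ w in {w : ℂ | c ≤ ‖w‖ ∧ c * w.re ^ 2 ≤ ‖w‖}, ENNReal.ofReal (4 / ‖w‖ ^ 2) < ⊤ := by
  have hm : MeasurableSet {w : ℂ | c ≤ ‖w‖ ∧ c * w.re ^ 2 ≤ ‖w‖} := by
    refine (measurableSet_le measurable_const measurable_norm).inter
      (measurableSet_le ?_ measurable_norm)
    exact (Complex.measurable_re.pow_const 2).const_mul c
  set K := 4 / c + 1 with hK
  have hK0 : 0 < K := by positivity
  refine lt_of_le_of_lt ?_ ((integrable_inv_rpow_im_mul_re.const_mul (4 * K ^ 2)).lintegral_lt_top)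
  refine (setLIntegral_mono' hm fun w hw => ?_).trans (setLIntegral_le_lintegral _ _)
  apply ENNReal.ofReal_le_ofReal
  obtain ⟨hw1, hw2⟩ := hw
  have hW : 0 < ‖w‖ := hc.trans_le hw1
  have hKW : K * ‖w‖ = 4 * (‖w‖ / c) + ‖w‖ := by
    rw [hK]
    ring
  have h1 : 1 ≤ ‖w‖ / c := (one_le_div hc).2 hw1
  have h2 : w.re ^ 2 ≤ ‖w‖ / c := (le_div_iff₀ hc).2 (by linarith)
  have hu : (1 + ‖w.re‖) ^ 2 ≤ K * ‖w‖ := by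
    rw [Real.norm_eq_abs]
    nlinarith [sq_nonneg (|w.re| - 1), sq_abs w.re]
  have hv : 1 + ‖w.im‖ ≤ K * ‖w‖ := by
    have := Complex.abs_im_le_norm w
    rw [Real.norm_eq_abs]
    linarith
  have hu' : (1 + ‖w.re‖) ^ (3 / 2 : ℝ) ≤ (K * ‖w‖) ^ (3 / 4 : ℝ) := by
    calc (1 + ‖w.re‖) ^ (3 / 2 : ℝ) = ((1 + ‖w.re‖) ^ 2) ^ (3 / 4 : ℝ) := by
          rw [← Real.rpow_natCast, ← Real.rpow_mul (by positivity)]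
          norm_num
      _ ≤ _ := Real.rpow_le_rpow (by positivity) hu (by norm_num)
  have hv' : (1 + ‖w.im‖) ^ (5 / 4 : ℝ) ≤ (K * ‖w‖) ^ (5 / 4 : ℝ) :=
    Real.rpow_le_rpow (by positivity) hv (by norm_num)
  have hprod : (1 + ‖w.re‖) ^ (3 / 2 : ℝ) * (1 + ‖w.im‖) ^ (5 / 4 : ℝ) ≤ (K * ‖w‖) ^ 2 := by
    calc _ ≤ (K * ‖w‖) ^ (3 / 4 : ℝ) * (K * ‖w‖) ^ (5 / 4 : ℝ) := by gcongr
      _ = (K * ‖w‖) ^ 2 := by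
          rw [← Real.rpow_add (by positivity), ← Real.rpow_natCast]
          norm_num
  rw [Real.rpow_neg (by positivity), Real.rpow_neg (by positivity), ← mul_inv, ← div_eq_mul_inv,
    div_le_div_iff₀ (by positivity) (by positivity)]
  nlinarith

/-- Pulling back by one step: the area of a preimage in a strip. -/
theorem volume_strip_inter_preimage_le (P : Polynomial ℂ) (hdeg : 2 ≤ P.natDegree) {X : ℝ}
    (hX : ∀ z : ℂ, X ≤ |z.re| → 0 < ‖expQuotient P z‖ ∧
      ‖expQuotient P z‖ / 2 ≤ ‖deriv (expQuotient P) z‖)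
    (a : ℝ) {B : Set ℂ} (hB : MeasurableSet B) :
    volume (halfOpenStrip a ∩ ({z | X ≤ |z.re|} ∩ expQuotient P ⁻¹' B)) ≤
      P.natDegree * ∫⁻ w in B, ENNReal.ofReal (4 / ‖w‖ ^ 2) := by
  set f := expQuotient P with hf
  have hfd : Differentiable ℂ f := differentiable_expQuotient P
  have hsm : MeasurableSet (halfOpenStrip a ∩ {z : ℂ | X ≤ |z.re|}) :=
    (measurableSet_halfOpenStrip a).inter
      (measurableSet_le measurable_const (Complex.measurable_re.abs))
  have hBm : MeasurableSet (f ⁻¹' B) := hB.preimage hfd.continuous.measurable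
  set g : ℂ → ENNReal := B.indicator fun w => ENNReal.ofReal (4 / ‖w‖ ^ 2) with hg
  have hgm : Measurable g := by
    refine Measurable.indicator ?_ hB
    exact (measurable_const.div (measurable_norm.pow_const 2)).ennreal_ofReal
  rw [← lintegral_indicator hB, ← Set.inter_assoc]
  refine le_trans ?_ (lintegral_norm_deriv_sq_mul_comp_le hfd hsm (N := P.natDegree) ?_ ?_ hgm)
  · rw [← setLIntegral_one, Set.inter_comm, ← setLIntegral_indicator hBm]
    refine setLIntegral_mono' hsm fun z hz => ?_
    by_cases hzB : f z ∈ B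
    · obtain ⟨h1, h2⟩ := hX z hz.2
      have hz' : z ∈ f ⁻¹' B := hzB
      rw [Set.indicator_of_mem hz', Set.indicator_of_mem hzB,
        ← ENNReal.ofReal_mul (by positivity), ENNReal.one_le_ofReal, mul_div_assoc',
        one_le_div (by positivity)]
      nlinarith
    · have hz' : z ∉ f ⁻¹' B := hzB
      rw [Set.indicator_of_notMem hz']
      exact zero_le
  · intro z hz h0
    obtain ⟨h1, h2⟩ := hX z hz.2
    rw [h0, norm_zero] at h2
    linarith
  · intro w
    refine (Set.encard_le_encard ?_).trans (encard_preimage_expQuotient_le P hdeg a w)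
    exact fun z hz => ⟨hz.1.1, hz.2⟩

/-! ### Area of the stalling points -/

/-- The points whose orbit stays in `|Re z| ≥ X` for `n` steps and then fails to grow
exponentially in the next step. -/
def stallSet (f : ℂ → ℂ) (X : ℝ) : ℕ → Set ℂ
  | 0 => {z | X ≤ |z.re| ∧ |(f z).re| < Real.exp (|z.re| / 2)}
  | n + 1 => {z | X ≤ |z.re|} ∩ f ⁻¹' stallSet f X n

theorem le_abs_re_of_mem_stallSet {f : ℂ → ℂ} {X : ℝ} {n : ℕ} {z : ℂ}
    (hz : z ∈ stallSet f X n) : X ≤ |z.re| := by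
  cases n with
  | zero => exact hz.1
  | succ n => exact hz.1

theorem measurableSet_stallSet {f : ℂ → ℂ} (hf : Measurable f) (X : ℝ) (n : ℕ) :
    MeasurableSet (stallSet f X n) := by
  have h : MeasurableSet {z : ℂ | X ≤ |z.re|} :=
    measurableSet_le measurable_const Complex.measurable_re.abs
  induction n with
  | zero =>
    refine h.inter (measurableSet_lt (Complex.measurable_re.comp hf).abs ?_)
    exact (Complex.measurable_re.abs.div_const 2).exp
  | succ n ih => exact h.inter (ih.preimage hf)

theorem expQuotient_add_int_mul (P : Polynomial ℂ) (j : ℤ) (z : ℂ) :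
    expQuotient P (z + j * (2 * Real.pi * Complex.I)) = expQuotient P z := by
  have h : Complex.exp (z + j * (2 * Real.pi * Complex.I)) = Complex.exp z :=
    Complex.exp_eq_exp_iff_exists_int.2 ⟨j, rfl⟩
  rw [expQuotient, expQuotient, h]

theorem add_int_mul_mem_stallSet (P : Polynomial ℂ) (X : ℝ) (n : ℕ) (j : ℤ) (z : ℂ) :
    z + j * (2 * Real.pi * Complex.I) ∈ stallSet (expQuotient P) X n ↔
      z ∈ stallSet (expQuotient P) X n := by
  have hre : (z + j * (2 * Real.pi * Complex.I)).re = z.re := by simp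
  cases n with
  | zero =>
    refine and_congr (by rw [hre]) ?_
    rw [expQuotient_add_int_mul, hre]
  | succ n =>
    refine and_congr (iff_of_eq (congrArg (fun x : ℝ => X ≤ |x|) hre)) ?_
    rw [Set.mem_preimage, Set.mem_preimage, expQuotient_add_int_mul]

theorem exists_volume_stallSet (P : Polynomial ℂ) (hdeg : 2 ≤ P.natDegree) (hP0 : P.eval 0 ≠ 0) :
    ∃ X : ℝ, 8 ≤ X ∧ ∀ a : ℝ,
      volume (halfOpenStrip a ∩ ⋃ n, stallSet (expQuotient P) X n) < ⊤ := by
  obtain ⟨X₁, c, hc, -, -, hlow⟩ := exists_asymptotics P hdeg hP0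
  -- The multiplicity `d` cancels, leaving a contraction factor `1/2` per pull-back.
  obtain ⟨X₂, hX₂⟩ := exists_tsum_inv_sq_add_sq_le (ε := 2⁻¹ / P.natDegree)
    (ENNReal.div_ne_zero.2 ⟨by simp, by simp⟩)
  set f := expQuotient P with hf
  have hfd : Differentiable ℂ f := differentiable_expQuotient P
  have hfm : Measurable f := hfd.continuous.measurable
  set X := max 8 (max X₁ X₂) with hX
  have hX8 : 8 ≤ X := le_max_left _ _
  have hXX₁ : X₁ ≤ X := (le_max_left _ _).trans (le_max_right _ _)
  have hXX₂ : X₂ ≤ X := (le_max_right _ _).trans (le_max_right _ _)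
  have hstep : ∀ z : ℂ, X ≤ |z.re| → 0 < ‖f z‖ ∧ ‖f z‖ / 2 ≤ ‖deriv f z‖ := fun z hz =>
    ⟨(by positivity : 0 < c * Real.exp |z.re|).trans_le (hlow z (hXX₁.trans hz)).1,
      (hlow z (hXX₁.trans hz)).2⟩
  have hpull := fun a B hB => volume_strip_inter_preimage_le P hdeg hstep a (B := B) hB
  have hzero : ∀ a, volume (halfOpenStrip a ∩ stallSet f X 0) < ⊤ := by
    intro a
    have hBm : MeasurableSet {w : ℂ | c ≤ ‖w‖ ∧ c * w.re ^ 2 ≤ ‖w‖} :=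
      (measurableSet_le measurable_const measurable_norm).inter
        (measurableSet_le ((Complex.measurable_re.pow_const 2).const_mul c) measurable_norm)
    refine (measure_mono (Set.inter_subset_inter_right _ ?_)).trans_lt
      ((hpull a _ hBm).trans_lt
        (ENNReal.mul_lt_top (ENNReal.natCast_lt_top _) (setLIntegral_inv_norm_sq_lt_top hc)))
    rintro z ⟨hz, hz'⟩
    have h1 := (hlow z (hXX₁.trans hz)).1
    refine ⟨hz, le_trans (le_mul_of_one_le_right hc.le (Real.one_le_exp (abs_nonneg _))) h1,
      le_trans (mul_le_mul_of_nonneg_left ?_ hc.le) h1⟩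
    calc (f z).re ^ 2 = |(f z).re| ^ 2 := (sq_abs _).symm
      _ ≤ Real.exp (|z.re| / 2) ^ 2 := pow_le_pow_left₀ (abs_nonneg _) hz'.le 2
      _ = Real.exp |z.re| := by
        rw [← Real.exp_nat_mul]
        congr 1
        push_cast
        ring
  -- The right side always uses the strip at `-π`: iterate there, then pass to `a` in a single step.
  have hsucc : ∀ a n, volume (halfOpenStrip a ∩ stallSet f X (n + 1)) ≤
      2⁻¹ * volume (halfOpenStrip (-Real.pi) ∩ stallSet f X n) := by
    intro a n
    have hm := measurableSet_stallSet hfm X n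
    refine (hpull a _ hm).trans ((mul_le_mul_right (setLIntegral_inv_norm_sq_le hm
      (add_int_mul_mem_stallSet P X n) (by linarith) fun z => le_abs_re_of_mem_stallSet) _).trans ?_)
    rw [← mul_assoc]
    gcongr
    refine (mul_le_mul_right (hX₂ X hXX₂) _).trans ?_
    exact ENNReal.mul_div_le
  refine ⟨X, hX8, fun a => ?_⟩
  have hgeom : ∀ n, volume (halfOpenStrip (-Real.pi) ∩ stallSet f X n) ≤
      2⁻¹ ^ n * volume (halfOpenStrip (-Real.pi) ∩ stallSet f X 0) := by
    intro n
    induction n with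
    | zero => simp
    | succ n ih =>
      refine (hsucc _ n).trans ?_
      rw [pow_succ', mul_assoc]
      gcongr
  rw [Set.inter_iUnion]
  refine (measure_iUnion_le _).trans_lt ?_
  rw [tsum_eq_zero_add' ENNReal.summable]
  refine ENNReal.add_lt_top.2 ⟨hzero a, ?_⟩
  refine (ENNReal.tsum_le_tsum fun n => (hsucc a n).trans
    (mul_le_mul_right (hgeom n) _)).trans_lt ?_
  rw [ENNReal.tsum_mul_left, ENNReal.tsum_mul_right, ENNReal.tsum_geometric]
  refine ENNReal.mul_lt_top (by simp) (ENNReal.mul_lt_top ?_ (hzero _))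
  simp

/-! ### Exponential growth implies fast escape -/

theorem one_add_sq_le_exp_half {x : ℝ} (hx : 0 ≤ x) : (1 + x / 4) ^ 2 ≤ Real.exp (x / 2) := by
  have h : Real.exp (x / 2) = Real.exp (x / 4) ^ 2 := by
    rw [← Real.exp_nat_mul]
    congr 1
    push_cast
    ring
  rw [h]
  exact pow_le_pow_left₀ (by positivity) (by linarith [Real.add_one_le_exp (x / 4)]) 2

theorem add_one_le_exp_half {x : ℝ} (hx : 8 ≤ x) : x + 1 ≤ Real.exp (x / 2) := by
  nlinarith [one_add_sq_le_exp_half (by linarith : 0 ≤ x)]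

theorem exp_le_of_forall_notMem_stallSet {f : ℂ → ℂ} {X : ℝ} (hX : 8 ≤ X) {z : ℂ}
    (hz : X ≤ |z.re|) (hn : ∀ n, z ∉ stallSet f X n) (n : ℕ) :
    X ≤ |(f^[n] z).re| ∧ Real.exp (|(f^[n] z).re| / 2) ≤ |(f^[n + 1] z).re| := by
  induction n generalizing z with
  | zero =>
    refine ⟨hz, ?_⟩
    by_contra! h
    exact hn 0 ⟨hz, h⟩
  | succ n ih =>
    rw [Function.iterate_succ_apply, Function.iterate_succ_apply]
    refine ih ?_ fun n h => hn (n + 1) ⟨hz, h⟩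
    have h1 : Real.exp (|z.re| / 2) ≤ |(f z).re| := by
      by_contra! h
      exact hn 0 ⟨hz, h⟩
    linarith [add_one_le_exp_half (hX.trans hz)]

theorem maxModulus_nonneg (f : ℂ → ℂ) (r : ℝ) : 0 ≤ maxModulus f r := by
  refine Real.sSup_nonneg ?_
  rintro _ ⟨z, -, rfl⟩
  exact norm_nonneg _

theorem norm_le_maxModulus {f : ℂ → ℂ} (hf : Continuous f) (z : ℂ) :
    ‖f z‖ ≤ maxModulus f ‖z‖ := by
  refine le_csSup ?_ ⟨z, by simp, rfl⟩
  exact ((isCompact_sphere (0 : ℂ) ‖z‖).image hf.norm).bddAbove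

theorem maxModulus_expQuotient_le {P : Polynomial ℂ} {K : ℝ}
    (hK0 : 0 ≤ K) (hK : ∀ z : ℂ, ‖expQuotient P z‖ ≤ K * Real.exp (P.natDegree * |z.re|)) (r : ℝ) :
    maxModulus (expQuotient P) r ≤ K * Real.exp (P.natDegree * r) := by
  refine Real.sSup_le ?_ (by positivity)
  rintro _ ⟨z, hz, rfl⟩
  refine (hK z).trans ?_
  have hz' : |z.re| ≤ r := (Complex.abs_re_le_norm z).trans (le_of_eq (by simpa using hz))
  gcongr

/-- Iterating `x ↦ e^{x/2}` eventually overtakes the iterates of the maximum modulus. -/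
theorem mem_fastEscapingSet_of_exp_le (P : Polynomial ℂ) (hdeg : 2 ≤ P.natDegree) {z : ℂ}
    (h8 : ∀ n, 8 ≤ |((expQuotient P)^[n] z).re|)
    (hexp : ∀ n, Real.exp (|((expQuotient P)^[n] z).re| / 2) ≤ |((expQuotient P)^[n + 1] z).re|)
    {R : ℝ} (hR : 0 ≤ R) : z ∈ fastEscapingSet (expQuotient P) R := by
  obtain ⟨K, hK0, hK⟩ := exists_norm_expQuotient_le P (by omega)
  set f := expQuotient P with hf
  set d : ℝ := (P.natDegree : ℝ) with hd
  have hd1 : 1 ≤ d := by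
    rw [hd]
    exact_mod_cast (by omega)
  have hlin : ∀ n : ℕ, (n : ℝ) ≤ |(f^[n] z).re| := by
    intro n
    induction n with
    | zero => simp
    | succ n ih =>
      push_cast
      linarith [hexp n, add_one_le_exp_half (h8 n)]
  -- If `x ≥ Dy + L`, then `e^{x/2} ≥ e^{dy} e^{L/2}`. `L` is chosen so that `e^{L/2} ≥ DK + L`,
  -- which makes `x ≥ Dy + L` persist under `y ↦ M(y) ≤ K e^{dy}`.
  set D := 2 * d with hD
  set L := 16 * (1 + D * K) with hL
  have hDK : 0 ≤ D * K := by positivity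
  have hLexp : D * K + L ≤ Real.exp (L / 2) := by
    nlinarith [one_add_sq_le_exp_half (by positivity : 0 ≤ L)]
  obtain ⟨ℓ, hℓ⟩ := exists_nat_ge (D * R + L)
  have hy : ∀ n, 0 ≤ (maxModulus f)^[n] R := by
    intro n
    cases n with
    | zero => exact hR
    | succ n =>
      rw [Function.iterate_succ_apply']
      exact maxModulus_nonneg _ _
  have hmain : ∀ n, D * (maxModulus f)^[n] R + L ≤ |(f^[n + ℓ] z).re| := by
    intro n
    induction n with
    | zero =>
      rw [zero_add]
      exact hℓ.trans (hlin ℓ)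
    | succ n ih =>
      set y := (maxModulus f)^[n] R with hyn
      have h1 := maxModulus_expQuotient_le hK0 hK y
      have h2 : 1 ≤ Real.exp (d * y) := Real.one_le_exp (mul_nonneg (by linarith) (hy n))
      have h3 : Real.exp (d * y) * Real.exp (L / 2) ≤ |(f^[n + ℓ + 1] z).re| := by
        rw [← Real.exp_add]
        refine le_trans (Real.exp_le_exp.2 ?_) (hexp (n + ℓ))
        linarith
      rw [Function.iterate_succ_apply', add_right_comm]
      calc D * maxModulus f y + L ≤ D * (K * Real.exp (d * y)) + L * Real.exp (d * y) := by
            gcongr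
            exact le_mul_of_one_le_right (by positivity) h2
        _ = Real.exp (d * y) * (D * K + L) := by ring
        _ ≤ Real.exp (d * y) * Real.exp (L / 2) := by gcongr
        _ ≤ _ := h3
  refine ⟨ℓ, fun n => ?_⟩
  have h1 := hmain n
  have h2 : 0 ≤ L := by positivity
  have h3 := Complex.abs_re_le_norm (f^[n + ℓ] z)
  nlinarith [hy n]

theorem volume_halfOpenStrip_inter_compl_fastEscapingSet_lt_top (P : Polynomial ℂ)
    (hdeg : 2 ≤ P.natDegree) (hP0 : P.eval 0 ≠ 0) {R : ℝ} (hR : 0 ≤ R) (a : ℝ) :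
    volume (halfOpenStrip a ∩ (fastEscapingSet (expQuotient P) R)ᶜ) < ⊤ := by
  obtain ⟨X, hX8, hX⟩ := exists_volume_stallSet P hdeg hP0
  have hsub : halfOpenStrip a ∩ (fastEscapingSet (expQuotient P) R)ᶜ ⊆
      (Set.Icc (-X) X ×ℂ Set.Icc a (a + 2 * Real.pi)) ∪
        (halfOpenStrip a ∩ ⋃ n, stallSet (expQuotient P) X n) := by
    rintro z ⟨hza, hz⟩
    by_cases hzX : |z.re| ≤ X
    · exact Or.inl ⟨abs_le.1 hzX, hza.1, hza.2.le⟩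
    · refine Or.inr ⟨hza, ?_⟩
      by_contra hn
      rw [Set.mem_iUnion, not_exists] at hn
      have h := exp_le_of_forall_notMem_stallSet hX8 (not_le.1 hzX).le hn
      exact hz (mem_fastEscapingSet_of_exp_le P hdeg (fun n => hX8.trans (h n).1)
        (fun n => (h n).2) hR)
  refine (measure_mono hsub).trans_lt ((measure_union_le _ _).trans_lt
    (ENNReal.add_lt_top.2 ⟨?_, hX a⟩))
  exact (isCompact_Icc.reProdIm isCompact_Icc).measure_lt_top

/-! ### Closed strips, admissible radii and conclusion -/

theorem volume_horizontalStrip_inter_compl_fastEscapingSet_lt_top (P : Polynomial ℂ)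
    (hdeg : 2 ≤ P.natDegree) (hP0 : P.eval 0 ≠ 0) {R : ℝ} (hR : 0 ≤ R) (a : ℝ) :
    volume (horizontalStrip a ∩ (fastEscapingSet (expQuotient P) R)ᶜ) < ⊤ := by
  have hsub : horizontalStrip a ⊆ halfOpenStrip a ∪ halfOpenStrip (a + 2 * Real.pi) := by
    rintro z ⟨h1, h2⟩
    rcases h2.lt_or_eq with h | h
    · exact Or.inl ⟨h1, h⟩
    · exact Or.inr ⟨h.ge, by linarith [Real.two_pi_pos]⟩
  refine (measure_mono (Set.inter_subset_inter_left _ hsub)).trans_lt ?_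
  rw [Set.union_inter_distrib_right]
  exact (measure_union_le _ _).trans_lt (ENNReal.add_lt_top.2
    ⟨volume_halfOpenStrip_inter_compl_fastEscapingSet_lt_top P hdeg hP0 hR a,
      volume_halfOpenStrip_inter_compl_fastEscapingSet_lt_top P hdeg hP0 hR _⟩)

/-- For large `r`, `M(r) ≥ |f(r)| ≥ c e^r ≥ c r²/2 ≥ 2r ≥ r + 1`, so the iterates grow at least
linearly. -/
theorem exists_isFastRadius (P : Polynomial ℂ) (hdeg : 2 ≤ P.natDegree) (hP0 : P.eval 0 ≠ 0) :
    ∃ R : ℝ, IsFastRadius (expQuotient P) R := by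
  obtain ⟨X, c, hc, -, -, hlow⟩ := exists_asymptotics P hdeg hP0
  set f := expQuotient P with hf
  have hfc : Continuous f := continuous_expQuotient P
  set R := max 8 (max X (4 / c)) with hR
  have h8 : 8 ≤ R := le_max_left _ _
  have hXR : X ≤ R := (le_max_left _ _).trans (le_max_right _ _)
  have hcR : 4 / c ≤ R := (le_max_right _ _).trans (le_max_right _ _)
  have hgrow : ∀ r, R ≤ r → r + 1 ≤ maxModulus f r := by
    intro r hr
    have hr0 : 0 ≤ r := by linarith
    have h1 := norm_le_maxModulus hfc (r : ℂ)
    have h2 := (hlow (r : ℂ) (by simpa [abs_of_nonneg hr0] using hXR.trans hr)).1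
    rw [Complex.norm_real, Real.norm_of_nonneg hr0] at h1
    rw [Complex.ofReal_re, abs_of_nonneg hr0] at h2
    have h3 : r ^ 2 / 2 ≤ Real.exp r := Real.pow_div_factorial_le_exp r hr0 2
    have h4 : 4 ≤ c * r := by
      have := (div_le_iff₀ hc).1 (hcR.trans hr)
      linarith
    have h5 : 2 * r ≤ c * (r ^ 2 / 2) := by nlinarith
    have h6 := mul_le_mul_of_nonneg_left h3 hc.le
    linarith
  refine ⟨R, by linarith, ?_⟩
  have hlin : ∀ n : ℕ, R + n ≤ (maxModulus f)^[n] R := by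
    intro n
    induction n with
    | zero => simp
    | succ n ih =>
      rw [Function.iterate_succ_apply']
      have := hgrow _ (le_trans (le_add_of_nonneg_right (Nat.cast_nonneg n)) ih)
      push_cast
      linarith
  exact tendsto_atTop_mono hlin (tendsto_atTop_add_const_left _ _ tendsto_natCast_atTop_atTop)

theorem theorem1p1 (P : Polynomial ℂ) (hdeg : 2 ≤ P.natDegree) (hP0 : P.eval 0 ≠ 0) :
    (∃ R : ℝ, IsFastRadius (expQuotient P) R) ∧
    (∀ R : ℝ, IsFastRadius (expQuotient P) R →
      (∀ a : ℝ, volume (horizontalStrip a ∩ (fastEscapingSet (expQuotient P) R)ᶜ) < ⊤) ∧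
      fastEscapingSet (expQuotient P) R ⊆ juliaSet (expQuotient P)) ∧
    (∀ a : ℝ, volume (horizontalStrip a ∩ fatouSet (expQuotient P)) < ⊤) := by
  have hfast := exists_isFastRadius P hdeg hP0
  refine ⟨hfast, fun R hR => ⟨fun a =>
    volume_horizontalStrip_inter_compl_fastEscapingSet_lt_top P hdeg hP0 hR.1.le a,
    fastEscapingSet_subset_juliaSet P hdeg hP0 hR⟩, fun a => ?_⟩
  obtain ⟨R, hR⟩ := hfast
  refine (measure_mono (Set.inter_subset_inter_right _ ?_)).trans_lt
    (volume_horizontalStrip_inter_compl_fastEscapingSet_lt_top P hdeg hP0 hR.1.le a)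
  exact Set.subset_compl_comm.1 (fastEscapingSet_subset_juliaSet P hdeg hP0 hR)
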